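/- Let $H=-\frac{d^2}{dx^2}+i\,\mathrm{sgn}(x)$ in $L^2(\mathbb{R})$, $\mathrm{Dom}(H)=W^{2,2}(\mathbb{R})$, which is the operator associated with the sesquilinear form $$h(\psi,\phi)=\int_{\mathbb{R}}\psi'\overline{\phi'}\,dx+i\int_0^{\infty}\psi\overline{\phi}\,dx-i\int_{-\infty}^0\psi\overline{\phi}\,dx,\qquad \mathrm{Dom}(h)=W^{1,2}(\mathbb{R}).$$ For a complex-valued $V\in L^1(\mathbb{R})$ and $\varepsilon\in\mathbb{R}$, let $H_\varepsilon=H\,\dot{+}\,\varepsilon V$ be the operator in $L^2(\mathbb{R})$ associated with the form $h+\varepsilon v$, where $v(\psi,\phi)=\int_{\mathbb{R}}V\psi\overline{\phi}\,dx$ on $\mathrm{Dom}(v)=\{\psi\in L^2(\mathbb{R}):|V|^{1/2}\psi\in L^2(\mathbb{R})\}$. That is, $\psi\in\mathrm{Dom}(h)\cap\mathrm{Dom}(v)$ belongs to $\mathrm{Dom}(H_\varepsilon)$ and $H_\varepsilon\psi=\eta\in L^2(\mathbb{R})$ if and only if $(h+\varepsilon v)(\psi,\phi)=(\eta,\phi)$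 for all $\phi\in\mathrm{Dom}(h)\cap\mathrm{Dom}(v)$. Let $\sigma_{\mathrm p}(H_\varepsilon)$ be the set of eigenvalues of $H_\varepsilon$ and $\mathcal{S}=[0,\infty)+i(-1,1)$. There exist universal constants $C_1,C_2>0$ (independent of $V$ and $\varepsilon$) such that, for every $V\in L^1(\mathbb{R},(1+x^2)\,dx)$ and every $\varepsilon\in\mathbb{R}$ with $$|\varepsilon|\,\big\|(1+|\cdot|^2)V\big\|_{L^1(\mathbb{R})}\le\frac1{C_1},$$ we have $$\sigma_{\mathrm p}(H_\varepsilon)\subset\overline{\mathcal{S}}\cap\Big\{z\in\mathbb{C}:\ \mathrm{Re}\,z\ge\frac{C_2}{\varepsilon^2\|V\|_{L^1(\mathbb{R})}^2}\Big\},$$ where the right-hand side is read as the empty set if $\varepsilon\|V\|_{L^1(\mathbb{R})}=0$. -/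

import Mathlib

open MeasureTheory Complex
open scoped ContDiff ComplexConjugate

noncomputable section

namespace HalfLineStep

/-! ### Sesquilinear forms and the operators associated with them -/

/-- A sesquilinear form in a complex Hilbert space: it is linear
in the first and conjugate-linear in the second argument. -/
structure SesqForm (E : Type*) [NormedAddCommGroup E] [InnerProductSpace ℂ E] where
  /-- The form domain. -/
  dom : Submodule ℂ E
  /-- The form itself. -/
  form : dom →ₗ[ℂ] dom →ₗ⋆[ℂ] ℂ

namespace SesqForm

variable {E : Type*} [NormedAddCommGroup E] [InnerProductSpace ℂ E]

/-- The sum of two forms, on the intersection of the two domains. -/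
def add (s t : SesqForm E) : SesqForm E where
  dom := s.dom ⊓ t.dom
  form := LinearMap.mk₂'ₛₗ (RingHom.id ℂ) (starRingEnd ℂ)
    (fun ψ φ => s.form ⟨ψ, ψ.2.1⟩ ⟨φ, φ.2.1⟩ + t.form ⟨ψ, ψ.2.2⟩ ⟨φ, φ.2.2⟩)
    (fun ψ₁ ψ₂ φ => by
      have h1 : s.form ⟨(ψ₁ + ψ₂ : E), (ψ₁ + ψ₂).2.1⟩ =
          s.form ⟨ψ₁, ψ₁.2.1⟩ + s.form ⟨ψ₂, ψ₂.2.1⟩ := by rw [← map_add]; rfl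
      have h2 : t.form ⟨(ψ₁ + ψ₂ : E), (ψ₁ + ψ₂).2.2⟩ =
          t.form ⟨ψ₁, ψ₁.2.2⟩ + t.form ⟨ψ₂, ψ₂.2.2⟩ := by rw [← map_add]; rfl
      simp only [Submodule.coe_add, h1, h2, LinearMap.add_apply]; ring)
    (fun c ψ φ => by
      have h1 : s.form ⟨(c • ψ : E), (c • ψ).2.1⟩ = c • s.form ⟨ψ, ψ.2.1⟩ := by
        rw [← map_smul]; rfl
      have h2 : t.form ⟨(c • ψ : E), (c • ψ).2.2⟩ = c • t.form ⟨ψ, ψ.2.2⟩ := by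
        rw [← map_smul]; rfl
      simp only [Submodule.coe_smul, h1, h2, LinearMap.smul_apply, smul_eq_mul,
        RingHom.id_apply]; ring)
    (fun ψ φ₁ φ₂ => by
      have h1 : s.form ⟨ψ, ψ.2.1⟩ ⟨(φ₁ + φ₂ : E), (φ₁ + φ₂).2.1⟩ =
          s.form ⟨ψ, ψ.2.1⟩ ⟨φ₁, φ₁.2.1⟩ + s.form ⟨ψ, ψ.2.1⟩ ⟨φ₂, φ₂.2.1⟩ := by
        rw [← map_add]; rfl
      have h2 : t.form ⟨ψ, ψ.2.2⟩ ⟨(φ₁ + φ₂ : E), (φ₁ + φ₂).2.2⟩ =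
          t.form ⟨ψ, ψ.2.2⟩ ⟨φ₁, φ₁.2.2⟩ + t.form ⟨ψ, ψ.2.2⟩ ⟨φ₂, φ₂.2.2⟩ := by
        rw [← map_add]; rfl
      simp only [Submodule.coe_add, h1, h2]; ring)
    (fun c ψ φ => by
      have h1 : s.form ⟨ψ, ψ.2.1⟩ ⟨(c • φ : E), (c • φ).2.1⟩ =
          conj c * s.form ⟨ψ, ψ.2.1⟩ ⟨φ, φ.2.1⟩ := by
        rw [← smul_eq_mul, ← LinearMap.map_smulₛₗ]; rfl
      have h2 : t.form ⟨ψ, ψ.2.2⟩ ⟨(c • φ : E), (c • φ).2.2⟩ =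
          conj c * t.form ⟨ψ, ψ.2.2⟩ ⟨φ, φ.2.2⟩ := by
        rw [← smul_eq_mul, ← LinearMap.map_smulₛₗ]; rfl
      simp only [Submodule.coe_smul, h1, h2, smul_eq_mul]; ring)

/-- A scalar multiple of a form, with the same domain. -/
def smul (c : ℂ) (t : SesqForm E) : SesqForm E where
  dom := t.dom
  form := c • t.form

/-- The domain of the operator associated with a form `t` (in the sense of the representation
theorem): all `ψ ∈ Dom t` for which there is `η` in the Hilbert space with `t(ψ, φ) = (η, φ)` for
all `φ ∈ Dom t`. (The inner product of Mathlib is linear in its second argument.) -/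
def operatorDom (t : SesqForm E) : Submodule ℂ E where
  carrier := {ψ | ∃ hψ : ψ ∈ t.dom, ∃ η : E, ∀ φ : t.dom,
    t.form ⟨ψ, hψ⟩ φ = inner ℂ (φ : E) η}
  zero_mem' := ⟨t.dom.zero_mem, 0, fun φ => by
    have : (⟨0, t.dom.zero_mem⟩ : t.dom) = 0 := rfl
    simp [this]⟩
  add_mem' := by
    rintro ψ₁ ψ₂ ⟨h₁, η₁, e₁⟩ ⟨h₂, η₂, e₂⟩
    refine ⟨t.dom.add_mem h₁ h₂, η₁ + η₂, fun φ => ?_⟩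
    have : (⟨ψ₁ + ψ₂, t.dom.add_mem h₁ h₂⟩ : t.dom) = ⟨ψ₁, h₁⟩ + ⟨ψ₂, h₂⟩ := rfl
    rw [this, map_add, LinearMap.add_apply, e₁, e₂, inner_add_right]
  smul_mem' := by
    rintro c ψ ⟨h, η, e⟩
    refine ⟨t.dom.smul_mem c h, c • η, fun φ => ?_⟩
    have : (⟨c • ψ, t.dom.smul_mem c h⟩ : t.dom) = c • ⟨ψ, h⟩ := rfl
    rw [this, map_smul, LinearMap.smul_apply, e, inner_smul_right, smul_eq_mul]

theorem mem_dom_of_mem_operatorDom {t : SesqForm E} (ψ : t.operatorDom) : (ψ : E) ∈ t.dom :=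
  ψ.2.choose

/-- The vector `η` with `t(ψ, φ) = (η, φ)` for all `φ ∈ Dom t`; it is unique if `Dom t` is
dense. -/
def operatorVal (t : SesqForm E) (ψ : t.operatorDom) : E := ψ.2.choose_spec.choose

theorem inner_operatorVal {t : SesqForm E} (ψ : t.operatorDom) (φ : t.dom) :
    inner ℂ (φ : E) (t.operatorVal ψ) = t.form ⟨ψ, mem_dom_of_mem_operatorDom ψ⟩ φ :=
  (ψ.2.choose_spec.choose_spec φ).symm

/-- The operator associated with a densely defined form `t`: it maps `ψ` in the operator domain
to the unique `η` with `t(ψ, φ) = (η, φ)` for all `φ ∈ Dom t`. -/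
def operator (t : SesqForm E) (ht : Dense (t.dom : Set E)) : E →ₗ.[ℂ] E where
  domain := t.operatorDom
  toFun :=
    { toFun := t.operatorVal
      map_add' := fun ψ₁ ψ₂ => ht.eq_of_inner_right ℂ fun v hv => by
        have h := inner_operatorVal (ψ₁ + ψ₂) ⟨v, hv⟩
        have h₁ := inner_operatorVal ψ₁ ⟨v, hv⟩
        have h₂ := inner_operatorVal ψ₂ ⟨v, hv⟩
        have e : (⟨((ψ₁ + ψ₂ : t.operatorDom) : E), mem_dom_of_mem_operatorDom _⟩ : t.dom) =
          ⟨ψ₁, mem_dom_of_mem_operatorDom ψ₁⟩ + ⟨ψ₂, mem_dom_of_mem_operatorDom ψ₂⟩ := rfl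
        rw [e, map_add, LinearMap.add_apply, ← h₁, ← h₂] at h
        rw [inner_add_right]
        exact h
      map_smul' := fun c ψ => ht.eq_of_inner_right ℂ fun v hv => by
        have h := inner_operatorVal (c • ψ) ⟨v, hv⟩
        have h₁ := inner_operatorVal ψ ⟨v, hv⟩
        have e : (⟨((c • ψ : t.operatorDom) : E), mem_dom_of_mem_operatorDom _⟩ : t.dom) =
          c • ⟨ψ, mem_dom_of_mem_operatorDom ψ⟩ := rfl
        rw [e, map_smul, LinearMap.smul_apply, ← h₁] at h
        rw [RingHom.id_apply, inner_smul_right]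
        exact h }

end SesqForm

/-- The point spectrum (the set of eigenvalues) of an unbounded operator. -/
def pointSpectrum {E : Type*} [NormedAddCommGroup E] [InnerProductSpace ℂ E]
    (T : E →ₗ.[ℂ] E) : Set ℂ :=
  {z | ∃ ψ : T.domain, (ψ : E) ≠ 0 ∧ T ψ = z • (ψ : E)}

/-! ### The Sobolev space `W^{1,2}(ℝ)` -/

/-- The Hilbert space `L²(ℝ)` of complex-valued functions. -/
abbrev L2 : Type := Lp ℂ 2 (volume : Measure ℝ)

/-- `g` is the weak derivative of `f`: `∫ f χ' = - ∫ g χ` for all test functions `χ`. -/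
def IsWeakDeriv (f g : L2) : Prop :=
  ∀ χ : ℝ → ℝ, ContDiff ℝ ∞ χ → HasCompactSupport χ →
    ∫ x, deriv χ x • f x = - ∫ x, χ x • g x

theorem integrable_test_smul (f : L2) {χ : ℝ → ℝ} (h : Continuous χ) (hc : HasCompactSupport χ) :
    Integrable (fun x => χ x • f x) :=
  (((Lp.memLp f).locallyIntegrable (by norm_num)).integrable_smul_left_of_hasCompactSupport h hc)

theorem integrable_deriv_smul (f : L2) {χ : ℝ → ℝ} (h : ContDiff ℝ ∞ χ)
    (hc : HasCompactSupport χ) : Integrable (fun x => deriv χ x • f x) :=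
  integrable_test_smul f (h.continuous_deriv (by simp)) hc.deriv

theorem IsWeakDeriv.unique {f g g' : L2} (h : IsWeakDeriv f g) (h' : IsWeakDeriv f g') :
    g = g' := by
  apply Lp.ext
  refine ae_eq_of_integral_contDiff_smul_eq ((Lp.memLp g).locallyIntegrable (by norm_num))
    ((Lp.memLp g').locallyIntegrable (by norm_num)) fun χ h1 h2 => ?_
  have := h χ h1 h2
  rw [h' χ h1 h2] at this
  exact (neg_injective this).symm

theorem IsWeakDeriv.add {f₁ g₁ f₂ g₂ : L2} (h₁ : IsWeakDeriv f₁ g₁) (h₂ : IsWeakDeriv f₂ g₂) :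
    IsWeakDeriv (f₁ + f₂) (g₁ + g₂) := by
  intro χ hχ hc
  have e₁ : (fun x => deriv χ x • (f₁ + f₂ : L2) x) =ᵐ[volume]
      fun x => deriv χ x • f₁ x + deriv χ x • f₂ x := by
    filter_upwards [Lp.coeFn_add f₁ f₂] with x hx
    rw [hx, Pi.add_apply, smul_add]
  have e₂ : (fun x => χ x • (g₁ + g₂ : L2) x) =ᵐ[volume]
      fun x => χ x • g₁ x + χ x • g₂ x := by
    filter_upwards [Lp.coeFn_add g₁ g₂] with x hx
    rw [hx, Pi.add_apply, smul_add]
  rw [integral_congr_ae e₁, integral_congr_ae e₂,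
    integral_add (integrable_deriv_smul f₁ hχ hc) (integrable_deriv_smul f₂ hχ hc),
    integral_add (integrable_test_smul g₁ hχ.continuous hc)
      (integrable_test_smul g₂ hχ.continuous hc), h₁ χ hχ hc, h₂ χ hχ hc, neg_add]

theorem IsWeakDeriv.smul {f g : L2} (c : ℂ) (h : IsWeakDeriv f g) :
    IsWeakDeriv (c • f) (c • g) := by
  intro χ hχ hc
  have e₁ : (fun x => deriv χ x • (c • f : L2) x) =ᵐ[volume]
      fun x => c • (deriv χ x • f x) := by
    filter_upwards [Lp.coeFn_smul c f] with x hx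
    rw [hx, Pi.smul_apply, smul_comm]
  have e₂ : (fun x => χ x • (c • g : L2) x) =ᵐ[volume] fun x => c • (χ x • g x) := by
    filter_upwards [Lp.coeFn_smul c g] with x hx
    rw [hx, Pi.smul_apply, smul_comm]
  rw [integral_congr_ae e₁, integral_congr_ae e₂, integral_smul, integral_smul, h χ hχ hc,
    smul_neg]

theorem IsWeakDeriv.zero : IsWeakDeriv 0 0 := by
  have h : ∀ w : ℝ → ℝ, ∫ x, w x • (0 : L2) x = 0 := fun w => by
    rw [← integral_zero ℝ ℂ]
    apply integral_congr_ae
    filter_upwards [Lp.coeFn_zero ℂ 2 (volume : Measure ℝ)] with x hx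
    rw [hx, Pi.zero_apply, smul_zero]
  intro χ _ _
  rw [h, h, neg_zero]

/-- The Sobolev space `W^{1,2}(ℝ)`, as a subspace of `L²(ℝ)`. -/
def W12 : Submodule ℂ L2 where
  carrier := {f | ∃ g, IsWeakDeriv f g}
  zero_mem' := ⟨0, IsWeakDeriv.zero⟩
  add_mem' := fun ⟨_, h₁⟩ ⟨_, h₂⟩ => ⟨_, h₁.add h₂⟩
  smul_mem' := fun c _ ⟨_, h⟩ => ⟨_, h.smul c⟩

/-- The weak derivative `W^{1,2}(ℝ) → L²(ℝ)`. -/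
def weakDeriv : W12 →ₗ[ℂ] L2 where
  toFun f := f.2.choose
  map_add' f g := (f + g).2.choose_spec.unique (f.2.choose_spec.add g.2.choose_spec)
  map_smul' c f := (c • f).2.choose_spec.unique (f.2.choose_spec.smul c)

/-! ### The form of the unperturbed operator -/

theorem integrable_mul_conj (ψ φ : L2) : Integrable (fun x => ψ x * conj (φ x)) := by
  simpa [RCLike.inner_apply] using L2.integrable_inner (𝕜 := ℂ) φ ψ

/-- The bounded form `(ψ, φ) ↦ ∫_s ψ φ̄` in `L²(ℝ)`. -/
def setForm (s : Set ℝ) : L2 →ₗ[ℂ] L2 →ₗ⋆[ℂ] ℂ :=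
  LinearMap.mk₂'ₛₗ (RingHom.id ℂ) (starRingEnd ℂ)
    (fun ψ φ => ∫ x in s, ψ x * conj (φ x))
    (fun ψ₁ ψ₂ φ => by
      rw [← integral_add (integrable_mul_conj ψ₁ φ).integrableOn
        (integrable_mul_conj ψ₂ φ).integrableOn]
      apply integral_congr_ae
      filter_upwards [ae_restrict_of_ae (Lp.coeFn_add ψ₁ ψ₂)] with x hx
      rw [hx, Pi.add_apply, add_mul])
    (fun c ψ φ => by
      rw [RingHom.id_apply, ← integral_smul]
      apply integral_congr_ae
      filter_upwards [ae_restrict_of_ae (Lp.coeFn_smul c ψ)] with x hx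
      rw [hx, Pi.smul_apply, smul_eq_mul, smul_eq_mul, mul_assoc])
    (fun ψ φ₁ φ₂ => by
      rw [← integral_add (integrable_mul_conj ψ φ₁).integrableOn
        (integrable_mul_conj ψ φ₂).integrableOn]
      apply integral_congr_ae
      filter_upwards [ae_restrict_of_ae (Lp.coeFn_add φ₁ φ₂)] with x hx
      rw [hx, Pi.add_apply, map_add, mul_add])
    (fun c ψ φ => by
      rw [← integral_smul]
      apply integral_congr_ae
      filter_upwards [ae_restrict_of_ae (Lp.coeFn_smul c φ)] with x hx
      rw [hx, Pi.smul_apply, smul_eq_mul, smul_eq_mul, map_mul]; ring)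

/-- The form of the free Hamiltonian: `q(ψ, φ) = ∫ ψ' φ̄'` on `W^{1,2}(ℝ)`. -/
def kineticForm : W12 →ₗ[ℂ] W12 →ₗ⋆[ℂ] ℂ :=
  LinearMap.mk₂'ₛₗ (RingHom.id ℂ) (starRingEnd ℂ)
    (fun ψ φ => inner ℂ (weakDeriv φ) (weakDeriv ψ))
    (fun ψ₁ ψ₂ φ => by simp only [map_add, inner_add_right])
    (fun c ψ φ => by simp only [map_smul, inner_smul_right, RingHom.id_apply, smul_eq_mul])
    (fun ψ φ₁ φ₂ => by simp only [map_add, inner_add_left])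
    (fun c ψ φ => by simp only [map_smul, inner_smul_left, smul_eq_mul])

/-- The form `h(ψ, φ) = ∫ ψ' φ̄' + i ∫_{x > 0} ψ φ̄ - i ∫_{x < 0} ψ φ̄`, `Dom h = W^{1,2}(ℝ)`,
of the operator `H = -d²/dx² + i sgn x`. -/
def stepForm : SesqForm L2 where
  dom := W12
  form := kineticForm + (I • setForm (Set.Ioi 0) - I • setForm (Set.Iio 0)).domRestrict₁₂ W12 W12

/-! ### The form of the potential -/

theorem integrable_potential {V : ℝ → ℂ} (hV : Integrable V) {ψ φ : L2}
    (hψ : MemLp (fun x => (Real.sqrt ‖V x‖ : ℂ) * ψ x) 2)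
    (hφ : MemLp (fun x => (Real.sqrt ‖V x‖ : ℂ) * φ x) 2) :
    Integrable (fun x => V x * ψ x * conj (φ x)) := by
  have h := hψ.norm.integrable_mul hφ.norm
  refine h.mono ((hV.aestronglyMeasurable.mul (Lp.aestronglyMeasurable ψ)).mul
    (continuous_conj.comp_aestronglyMeasurable (Lp.aestronglyMeasurable φ))) (ae_of_all _ ?_)
  intro x
  have := Real.mul_self_sqrt (norm_nonneg (V x))
  simp only [norm_mul, Pi.mul_apply, norm_real, RCLike.norm_conj, Real.norm_eq_abs,
    abs_of_nonneg (Real.sqrt_nonneg _), abs_norm]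
  apply le_of_eq
  calc ‖V x‖ * ‖ψ x‖ * ‖φ x‖
      = (Real.sqrt ‖V x‖ * Real.sqrt ‖V x‖) * ‖ψ x‖ * ‖φ x‖ := by rw [this]
    _ = _ := by ring

/-- The form domain of the potential: all `ψ ∈ L²(ℝ)` with `|V|^{1/2} ψ ∈ L²(ℝ)`. -/
def potentialDom (V : ℝ → ℂ) : Submodule ℂ L2 where
  carrier := {ψ | MemLp (fun x => (Real.sqrt ‖V x‖ : ℂ) * ψ x) 2}
  zero_mem' := by
    refine (MemLp.zero (ε := ℂ) (μ := (volume : Measure ℝ))).ae_eq ?_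
    filter_upwards [Lp.coeFn_zero ℂ 2 (volume : Measure ℝ)] with x hx
    rw [hx, Pi.zero_apply, mul_zero]
  add_mem' := by
    intro ψ φ hψ hφ
    refine (MemLp.add hψ hφ).ae_eq ?_
    filter_upwards [Lp.coeFn_add ψ φ] with x hx
    rw [hx, Pi.add_apply, Pi.add_apply, mul_add]
  smul_mem' := by
    intro c ψ hψ
    refine (MemLp.const_smul hψ c).ae_eq ?_
    filter_upwards [Lp.coeFn_smul c ψ] with x hx
    rw [hx, Pi.smul_apply, Pi.smul_apply, smul_eq_mul, smul_eq_mul]; ring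

/-- The form `v(ψ, φ) = ∫ V ψ φ̄` of the operator of multiplication by `V ∈ L¹(ℝ)`. -/
def potentialForm (V : ℝ → ℂ) (hV : Integrable V) : SesqForm L2 where
  dom := potentialDom V
  form := LinearMap.mk₂'ₛₗ (RingHom.id ℂ) (starRingEnd ℂ)
    (fun ψ φ => ∫ x, V x * (ψ : L2) x * conj ((φ : L2) x))
    (fun ψ₁ ψ₂ φ => by
      rw [← integral_add (integrable_potential hV ψ₁.2 φ.2) (integrable_potential hV ψ₂.2 φ.2)]
      apply integral_congr_ae
      filter_upwards [Lp.coeFn_add (ψ₁ : L2) ψ₂] with x hx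
      rw [Submodule.coe_add, hx, Pi.add_apply]; ring)
    (fun c ψ φ => by
      rw [RingHom.id_apply, ← integral_smul]
      apply integral_congr_ae
      filter_upwards [Lp.coeFn_smul c (ψ : L2)] with x hx
      rw [Submodule.coe_smul, hx, Pi.smul_apply, smul_eq_mul, smul_eq_mul]; ring)
    (fun ψ φ₁ φ₂ => by
      rw [← integral_add (integrable_potential hV ψ.2 φ₁.2) (integrable_potential hV ψ.2 φ₂.2)]
      apply integral_congr_ae
      filter_upwards [Lp.coeFn_add (φ₁ : L2) φ₂] with x hx
      rw [Submodule.coe_add, hx, Pi.add_apply, map_add]; ring)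
    (fun c ψ φ => by
      rw [← integral_smul]
      apply integral_congr_ae
      filter_upwards [Lp.coeFn_smul c (φ : L2)] with x hx
      rw [Submodule.coe_smul, hx, Pi.smul_apply, smul_eq_mul, smul_eq_mul, map_mul]; ring)

/-! ### The perturbed operator -/

/-- The form `h_ε = h + ε v`, with domain `Dom h ∩ Dom v`. -/
def perturbedForm (V : ℝ → ℂ) (hV : Integrable V) (ε : ℝ) : SesqForm L2 :=
  stepForm.add ((potentialForm V hV).smul (ε : ℂ))

theorem dense_perturbedForm_dom (V : ℝ → ℂ) (hV : Integrable V) (ε : ℝ) :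
    Dense ((perturbedForm V hV ε).dom : Set L2) := by
  refine (Lp.dense_hasCompactSupport_contDiff (E := ℝ) (F := ℂ)
    (μ := (volume : Measure ℝ)) (p := 2) (by norm_num)).mono ?_
  rintro f ⟨g, hfg, hgc, hg⟩
  refine ⟨?_, ?_⟩
  · have hd : MemLp (deriv g) 2 (volume : Measure ℝ) :=
      (hg.continuous_deriv (by simp)).memLp_of_hasCompactSupport hgc.deriv
    refine ⟨hd.toLp, fun χ hχ hχc => ?_⟩
    have e₁ : (fun x => deriv χ x • f x) =ᵐ[volume] fun x => deriv χ x • g x := by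
      filter_upwards [hfg] with x hx
      rw [hx]
    have e₂ : (fun x => χ x • (hd.toLp : L2) x) =ᵐ[volume] fun x => χ x • deriv g x := by
      filter_upwards [hd.coeFn_toLp] with x hx
      rw [hx]
    rw [integral_congr_ae e₁, integral_congr_ae e₂]
    have cχ : Continuous (deriv χ) := hχ.continuous_deriv (by simp)
    have cg : Continuous (deriv g) := hg.continuous_deriv (by simp)
    have := integral_bilinear_hasDerivAt_right_eq_neg_left_of_integrable
      (L := ContinuousLinearMap.lsmul ℝ ℝ) (u := χ) (v := g) (u' := deriv χ) (v' := deriv g)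
      (fun x _ => ((hχ.differentiable (by simp)) x).hasDerivAt)
      (fun x _ => ((hg.differentiable (by simp)) x).hasDerivAt)
      ((hχ.continuous.smul cg).integrable_of_hasCompactSupport hχc.smul_right)
      ((cχ.smul hg.continuous).integrable_of_hasCompactSupport hgc.smul_left)
      ((hχ.continuous.smul hg.continuous).integrable_of_hasCompactSupport hχc.smul_right)
    simp only [ContinuousLinearMap.lsmul_apply] at this
    rw [this, neg_neg]
  · obtain ⟨M, hM⟩ := hgc.exists_bound_of_continuous hg.continuous
    have hs : MemLp (fun x => (Real.sqrt ‖V x‖ : ℂ)) 2 (volume : Measure ℝ) := by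
      have hm : AEStronglyMeasurable (fun x => (Real.sqrt ‖V x‖ : ℂ)) (volume : Measure ℝ) :=
        continuous_ofReal.comp_aestronglyMeasurable
          (Real.continuous_sqrt.comp_aestronglyMeasurable hV.aestronglyMeasurable.norm)
      rw [memLp_two_iff_integrable_sq_norm hm]
      simpa [Real.sq_sqrt, abs_of_nonneg (Real.sqrt_nonneg _)] using hV.norm
    have hb : MemLp (fun x => (Real.sqrt ‖V x‖ : ℂ) * g x) 2 (volume : Measure ℝ) := by
      refine (hs.norm.const_mul M).mono
        (hs.aestronglyMeasurable.mul hg.continuous.aestronglyMeasurable) (ae_of_all _ fun x => ?_)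
      have h0 : 0 ≤ M := (norm_nonneg _).trans (hM x)
      rw [norm_mul, norm_mul, norm_norm, Real.norm_eq_abs, abs_of_nonneg h0, mul_comm]
      exact mul_le_mul_of_nonneg_right (hM x) (norm_nonneg _)
    refine hb.ae_eq ?_
    filter_upwards [hfg] with x hx
    rw [hx]

/-- The operator `H_ε = H ∔ ε V` in `L²(ℝ)`, where `H = -d²/dx² + i sgn x` and the sum is
understood in the sense of forms. -/
def perturbedOperator (V : ℝ → ℂ) (hV : Integrable V) (ε : ℝ) : L2 →ₗ.[ℂ] L2 :=
  (perturbedForm V hV ε).operator (dense_perturbedForm_dom V hV ε)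

/-- `V ∈ L¹(ℝ, (1 + x²) dx)`. -/
def WeightedL1 (V : ℝ → ℂ) : Prop :=
  Integrable (fun x => (1 + x ^ 2 : ℝ) • V x)

theorem WeightedL1.integrable {V : ℝ → ℂ} (hV : WeightedL1 V) : Integrable V := by
  have hc : Continuous (fun x : ℝ => (1 + x ^ 2)⁻¹) :=
    Continuous.inv₀ (by fun_prop) fun x => by positivity
  have h : Integrable (fun x => (1 + x ^ 2 : ℝ)⁻¹ • ((1 + x ^ 2 : ℝ) • V x)) := by
    refine hV.mono (hc.aestronglyMeasurable.smul hV.aestronglyMeasurable) (ae_of_all _ fun x => ?_)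
    rw [norm_smul]
    refine mul_le_of_le_one_left (norm_nonneg _) ?_
    rw [norm_inv, Real.norm_eq_abs, abs_of_pos (by positivity)]
    exact inv_le_one_of_one_le₀ (by nlinarith [sq_nonneg x])
  refine h.congr (ae_of_all _ fun x => ?_)
  have : (1 + x ^ 2 : ℝ) ≠ 0 := by positivity
  simp only [smul_smul, inv_mul_cancel₀ this, one_smul]

/-- The half-strip `[0, ∞) + i (-1, 1)`. -/
def halfStrip : Set ℂ := {z | 0 ≤ z.re ∧ -1 < z.im ∧ z.im < 1}

end HalfLineStep

end

open HalfLineStep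

/-!
An eigenfunction `u` solves `u'' = (i sgn x + εV - z) u`, so with `k² = i - z`, `m² = -i - z`,
`Re k, Re m ≥ 0`, it satisfies `u'' = k² u + εVu` on the right and `u'' = m² u + εVu` on the left.
Factoring `∂² - k² = (∂ - k)(∂ + k)` and using that `u` and `u'` are square integrable gives
`|u' + ku|(x) ≤ ∫_x^∞ |εVu|` for `x ≥ 0`, and `|u' - mu|` is bounded likewise on the left. At
`x = 0` the two bounds add up to `|k + m| |u(0)| ≤ ∫ |εVu|`. Integrating them once more gives
`|u(x)| ≤ |u(0)| + ∫ |y| |εVu|`, hence `sup |u| ≤ 2 |u(0)|` when the first moment of `εV` is small,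
and therefore `|k + m| ≤ 2 |ε| ‖V‖₁`. The threshold has no singularity, since
`(k + m)(k - m) = 2i` keeps `k + m` away from zero for bounded `z`: with `s = k + m` one has
`k - m = 2i / s`, and `z = i - k²` is then far to the right and inside the closed strip when `s`
is small.
-/

namespace HalfLineStep

open Filter Set Topology

section Primitive

variable {E : Type*} [NormedAddCommGroup E]

theorem intervalIntegrable_of_locallyIntegrable {f : ℝ → E} (hf : LocallyIntegrable f) (a b : ℝ) :
    IntervalIntegrable f volume a b :=
  intervalIntegrable_iff.mpr <|
    (hf.integrableOn_isCompact isCompact_uIcc).mono_set uIoc_subset_uIcc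

variable [NormedSpace ℝ E]

/-- `F` is locally absolutely continuous and its almost everywhere derivative is `f`. The notion is
encoded by the fundamental theorem of calculus, so that differential equations with locally
integrable coefficients can be stated by it. -/
structure IsPrimitive (F f : ℝ → E) : Prop where
  locallyIntegrable : LocallyIntegrable f
  integral_eq_sub (a b : ℝ) : ∫ t in a..b, f t = F b - F a

theorem isPrimitive_const_add_integral {f : ℝ → E} (hf : LocallyIntegrable f) (C : E) (c : ℝ) :
    IsPrimitive (fun x => C + ∫ t in c..x, f t) f where
  locallyIntegrable := hf
  integral_eq_sub a b := by
    rw [add_sub_add_left_eq_sub, intervalIntegral.integral_interval_sub_left] <;>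
      exact intervalIntegrable_of_locallyIntegrable hf _ _

theorem absolutelyContinuousOnInterval_of_dist_le {X Y : Type*} [PseudoMetricSpace X]
    [PseudoMetricSpace Y] {f : ℝ → X} {g : ℝ → Y} {a b : ℝ}
    (hg : AbsolutelyContinuousOnInterval g a b) (h : ∀ x y, dist (f x) (f y) ≤ dist (g x) (g y)) :
    AbsolutelyContinuousOnInterval f a b :=
  squeeze_zero (fun _ => Finset.sum_nonneg fun _ _ => dist_nonneg)
    (fun _ => Finset.sum_le_sum fun _ _ => h _ _) hg

namespace IsPrimitive

variable {F f g : ℝ → E}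

theorem of_hasDerivAt [CompleteSpace E] (h : ∀ x, HasDerivAt F (f x) x) (hf : Continuous f) :
    IsPrimitive F f where
  locallyIntegrable := hf.locallyIntegrable
  integral_eq_sub a b :=
    intervalIntegral.integral_eq_sub_of_hasDerivAt (fun x _ => h x) (hf.intervalIntegrable a b)

theorem congr_ae (h : IsPrimitive F f) (hfg : f =ᵐ[volume] g) : IsPrimitive F g where
  locallyIntegrable := h.locallyIntegrable.congr hfg
  integral_eq_sub a b := by
    rw [← h.integral_eq_sub]
    exact intervalIntegral.integral_congr_ae (hfg.mono fun _ hx _ => hx.symm)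

theorem intervalIntegrable (h : IsPrimitive F f) (a b : ℝ) : IntervalIntegrable f volume a b :=
  intervalIntegrable_of_locallyIntegrable h.locallyIntegrable a b

theorem eq_add_integral (h : IsPrimitive F f) (a : ℝ) : F = fun x => F a + ∫ t in a..x, f t :=
  funext fun x => by rw [h.integral_eq_sub, add_sub_cancel]

theorem continuous (h : IsPrimitive F f) : Continuous F := by
  rw [h.eq_add_integral 0]
  exact continuous_const.add (intervalIntegral.continuous_primitive h.intervalIntegrable 0)

theorem ae_hasDerivAt [CompleteSpace E] (h : IsPrimitive F f) : ∀ᵐ x, HasDerivAt F (f x) x := by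
  filter_upwards [_root_.LocallyIntegrable.ae_hasDerivAt_integral h.locallyIntegrable] with x hx
  rw [h.eq_add_integral 0]
  exact (hx 0).const_add _

theorem hasDerivAt [CompleteSpace E] (h : IsPrimitive F f) (hf : Continuous f) (x : ℝ) :
    HasDerivAt F (f x) x := by
  rw [h.eq_add_integral 0]
  exact (intervalIntegral.integral_hasDerivAt_right (h.intervalIntegrable 0 x)
    hf.stronglyMeasurable.stronglyMeasurableAtFilter hf.continuousAt).const_add _

theorem absolutelyContinuousOnInterval (h : IsPrimitive F f) (a b : ℝ) :
    AbsolutelyContinuousOnInterval F a b := by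
  have hnorm (a b : ℝ) : IntervalIntegrable (fun x => ‖f x‖) volume a b :=
    (h.intervalIntegrable a b).norm
  refine absolutelyContinuousOnInterval_of_dist_le
    ((hnorm a b).absolutelyContinuousOnInterval_intervalIntegral left_mem_uIcc) fun x y => ?_
  rw [dist_eq_norm, dist_eq_norm, ← h.integral_eq_sub,
    intervalIntegral.integral_interval_sub_left (hnorm _ _) (hnorm _ _)]
  exact intervalIntegral.norm_integral_le_abs_integral_norm

protected theorem add {G : ℝ → E} (hF : IsPrimitive F f) (hG : IsPrimitive G g) :
    IsPrimitive (fun x => F x + G x) (fun x => f x + g x) where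
  locallyIntegrable := hF.locallyIntegrable.add hG.locallyIntegrable
  integral_eq_sub a b := by
    rw [intervalIntegral.integral_add (hF.intervalIntegrable a b) (hG.intervalIntegrable a b),
      hF.integral_eq_sub, hG.integral_eq_sub]
    abel

protected theorem const_smul {𝕜 : Type*} [NormedDivisionRing 𝕜] [Module 𝕜 E]
    [NormSMulClass 𝕜 E] [SMulCommClass ℝ 𝕜 E] (h : IsPrimitive F f) (c : 𝕜) :
    IsPrimitive (fun x => c • F x) (fun x => c • f x) where
  locallyIntegrable := h.locallyIntegrable.smul c
  integral_eq_sub a b := by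
    rw [intervalIntegral.integral_smul, h.integral_eq_sub, smul_sub]

theorem comp_neg (h : IsPrimitive F f) :
    IsPrimitive (fun x => F (-x)) (fun x => -f (-x)) where
  locallyIntegrable := by
    refine (locallyIntegrable_iff.mpr fun K hK => ?_ : LocallyIntegrable fun x => f (-x)).neg
    have := (Measure.measurePreserving_neg (volume : Measure ℝ)).integrableOn_comp_preimage
      (Homeomorph.neg ℝ).measurableEmbedding (f := f) (s := -K)
    simpa [Function.comp_def] using
      this.mpr (h.locallyIntegrable.integrableOn_isCompact hK.neg)
  integral_eq_sub a b := by
    rw [intervalIntegral.integral_neg, intervalIntegral.integral_comp_neg, h.integral_eq_sub,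
      neg_sub]

protected theorem smul {𝕜 : Type*} [NormedRing 𝕜] [NormedAlgebra ℝ 𝕜] [CompleteSpace 𝕜]
    [Module 𝕜 E] [NormSMulClass 𝕜 E] [IsScalarTower ℝ 𝕜 E] [CompleteSpace E] {P p : ℝ → 𝕜}
    (hP : IsPrimitive P p) (hF : IsPrimitive F f) :
    IsPrimitive (fun x => P x • F x) (fun x => P x • f x + p x • F x) := by
  have hint : LocallyIntegrable fun x => P x • f x + p x • F x :=
    (hF.locallyIntegrable.continuous_smul hP.continuous).add
      (hP.locallyIntegrable.smul_continuous hF.continuous)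
  refine ⟨hint, fun a b => ?_⟩
  have hQ := isPrimitive_const_add_integral hint 0 a
  obtain ⟨C, hC⟩ := AbsolutelyContinuousOnInterval.const_of_ae_hasDerivAt_zero
    (((hP.absolutelyContinuousOnInterval a b).smul (hF.absolutelyContinuousOnInterval a b)).sub
      (hQ.absolutelyContinuousOnInterval a b)) (by
      filter_upwards [hP.ae_hasDerivAt, hF.ae_hasDerivAt, hQ.ae_hasDerivAt] with x hPx hFx hQx _
      simpa using (hPx.smul hFx).sub hQx)
  have hCa := hC a left_mem_uIcc
  have hCb := hC b right_mem_uIcc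
  simp only [Pi.sub_apply, Pi.smul_apply', intervalIntegral.integral_same, zero_add,
    sub_zero] at hCa hCb
  rw [hCa, ← hCb, sub_sub_cancel]

theorem norm_le_add_integral_norm (h : IsPrimitive F f) (hf : Integrable f) (x : ℝ) :
    ‖F x‖ ≤ ‖F 0‖ + ∫ t, ‖f t‖ := by
  have hsub : ‖F x - F 0‖ ≤ ∫ t, ‖f t‖ := by
    rw [← h.integral_eq_sub]
    exact intervalIntegral.norm_integral_le_integral_norm_uIoc.trans
      (setIntegral_le_integral hf.norm (Eventually.of_forall fun _ => norm_nonneg _))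
  linarith [norm_sub_norm_le (F x) (F 0)]

theorem integral_eq_zero (h : IsPrimitive F f) (hF : HasCompactSupport F) (hf : Integrable f) :
    ∫ x, f x = 0 := by
  have hzero : F =ᶠ[atBot ⊔ atTop] 0 := by
    rw [← cocompact_eq_atBot_atTop, ← coclosedCompact_eq_cocompact]
    exact hasCompactSupport_iff_eventuallyEq.mp hF
  have hbot : ∀ᶠ x : ℝ in atTop, F (-x) = 0 :=
    tendsto_neg_atTop_atBot.eventually (hzero.filter_mono le_sup_left)
  have htop : ∀ᶠ x : ℝ in atTop, F x = 0 := hzero.filter_mono le_sup_right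
  refine tendsto_nhds_unique
    (intervalIntegral_tendsto_integral hf tendsto_neg_atTop_atBot tendsto_id) ?_
  refine tendsto_const_nhds.congr' ?_
  filter_upwards [hbot, htop] with x hneg hx
  rw [h.integral_eq_sub, id, hneg, hx, sub_zero]

theorem integral_deriv_smul [CompleteSpace E] (h : IsPrimitive F f) {χ : ℝ → ℝ}
    (hχ : ContDiff ℝ 1 χ) (hc : HasCompactSupport χ) :
    ∫ x, deriv χ x • F x = -∫ x, χ x • f x := by
  have hdχ : Continuous (deriv χ) := hχ.continuous_deriv le_rfl
  have hint : Integrable fun x => χ x • f x :=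
    h.locallyIntegrable.integrable_smul_left_of_hasCompactSupport hχ.continuous hc
  have hint' : Integrable fun x => deriv χ x • F x :=
    h.continuous.locallyIntegrable.integrable_smul_left_of_hasCompactSupport hdχ hc.deriv
  have hprod := (of_hasDerivAt (fun x => (hχ.differentiable one_ne_zero x).hasDerivAt) hdχ).smul h
  have hzero := hprod.integral_eq_zero hc.smul_right (hint.add hint')
  rw [integral_add hint hint'] at hzero
  exact eq_neg_of_add_eq_zero_right hzero

end IsPrimitive

theorem exists_contDiff_deriv_eq {θ : ℝ → ℝ} (hθ : ContDiff ℝ ∞ θ) (hc : HasCompactSupport θ)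
    (h0 : ∫ x, θ x = 0) : ∃ χ : ℝ → ℝ, ContDiff ℝ ∞ χ ∧ HasCompactSupport χ ∧ deriv χ = θ := by
  set χ : ℝ → ℝ := fun x => ∫ t in Iic x, θ t
  have hint : Integrable θ := hθ.continuous.integrable_of_hasCompactSupport hc
  have hχ : IsPrimitive χ θ := ⟨hint.locallyIntegrable, fun a b =>
    (intervalIntegral.integral_Iic_sub_Iic hint.integrableOn hint.integrableOn).symm⟩
  have hderiv (x : ℝ) : HasDerivAt χ (θ x) x := hχ.hasDerivAt hθ.continuous x
  have hderiv_eq : deriv χ = θ := funext fun x => (hderiv x).deriv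
  refine ⟨χ, contDiff_infty_iff_deriv.mpr
    ⟨fun x => (hderiv x).differentiableAt, hderiv_eq ▸ hθ⟩, ?_, hderiv_eq⟩
  obtain ⟨R, hR⟩ := hc.isCompact.isBounded.subset_closedBall 0
  rw [Real.closedBall_eq_Icc, zero_sub, zero_add] at hR
  have hout {t : ℝ} (ht : t ∉ Icc (-R) R) : θ t = 0 :=
    image_eq_zero_of_notMem_tsupport fun h => ht (hR h)
  refine HasCompactSupport.intro (isCompact_Icc (a := -R) (b := R)) fun x hx => ?_
  rcases lt_or_ge x (-R) with hlt | hge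
  · exact setIntegral_eq_zero_of_forall_eq_zero fun t ht => hout fun h => by
      linarith [h.1, mem_Iic.mp ht]
  · have hRx : R < x := not_le.mp fun h => hx ⟨hge, h⟩
    refine (setIntegral_eq_integral_of_forall_compl_eq_zero fun t ht => hout fun h => ?_).trans h0
    exact ht (h.2.trans hRx.le)

/-- The lemma of du Bois-Reymond. -/
theorem ae_eq_const_of_integral_deriv_smul_eq_zero [CompleteSpace E] {f : ℝ → E}
    (hf : LocallyIntegrable f)
    (h : ∀ χ : ℝ → ℝ, ContDiff ℝ ∞ χ → HasCompactSupport χ → ∫ x, deriv χ x • f x = 0) :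
    ∃ c : E, ∀ᵐ x, f x = c := by
  obtain ⟨η, hη, hηc, hη1⟩ :
      ∃ η : ℝ → ℝ, ContDiff ℝ ∞ η ∧ HasCompactSupport η ∧ ∫ x, η x = 1 :=
    let b : ContDiffBump (0 : ℝ) := ⟨1, 2, one_pos, one_lt_two⟩
    ⟨b.normed volume, b.contDiff_normed, b.hasCompactSupport_normed, b.integral_normed⟩
  refine ⟨∫ x, η x • f x, ae_eq_of_integral_contDiff_smul_eq hf
    continuous_const.locallyIntegrable fun φ hφ hφc => ?_⟩
  have hφi := hφ.continuous.integrable_of_hasCompactSupport hφc (μ := volume)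
  have hηi := hη.continuous.integrable_of_hasCompactSupport hηc (μ := volume)
  -- Subtracting a multiple of `η` gives mean zero, hence a compactly supported primitive.
  obtain ⟨χ, hχ, hχc, hderiv⟩ := exists_contDiff_deriv_eq (θ := fun x => φ x - (∫ t, φ t) * η x)
    (hφ.sub (contDiff_const.mul hη)) (hφc.sub hηc.mul_left) (by
      rw [integral_sub hφi (hηi.const_mul _), integral_const_mul, hη1, mul_one, sub_self])
  have hzero := h χ hχ hχc
  simp only [hderiv, sub_smul, mul_smul] at hzero
  rw [integral_sub (hf.integrable_smul_left_of_hasCompactSupport hφ.continuous hφc)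
    ((hf.integrable_smul_left_of_hasCompactSupport hη.continuous hηc).fun_smul _),
    integral_smul, sub_eq_zero] at hzero
  rw [hzero, integral_smul_const]

theorem exists_ae_eq_isPrimitive [CompleteSpace E] {f g : ℝ → E} (hf : LocallyIntegrable f)
    (hg : LocallyIntegrable g)
    (h : ∀ χ : ℝ → ℝ, ContDiff ℝ ∞ χ → HasCompactSupport χ →
      ∫ x, deriv χ x • f x = -∫ x, χ x • g x) :
    ∃ F : ℝ → E, f =ᵐ[volume] F ∧ IsPrimitive F g := by
  have hP := isPrimitive_const_add_integral hg 0 0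
  set P : ℝ → E := fun x => 0 + ∫ t in (0 : ℝ)..x, g t
  obtain ⟨c, hc⟩ := ae_eq_const_of_integral_deriv_smul_eq_zero
    (hf.sub hP.continuous.locallyIntegrable) fun χ hχ hχc => by
      have hdχ : Continuous (deriv χ) := hχ.continuous_deriv (by simp)
      simp only [Pi.sub_apply, smul_sub]
      rw [integral_sub (hf.integrable_smul_left_of_hasCompactSupport hdχ hχc.deriv)
        (hP.continuous.locallyIntegrable.integrable_smul_left_of_hasCompactSupport hdχ hχc.deriv),
        h χ hχ hχc, hP.integral_deriv_smul (hχ.of_le (by simp)) hχc, sub_self]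
  refine ⟨_, hc.mono fun x hx => ?_, isPrimitive_const_add_integral hg c 0⟩
  simp only [← hx, P, Pi.sub_apply, zero_add, sub_add_cancel]

end Primitive

section HalfLine

theorem IsPrimitive.eq_neg_integral_Ioi {E : Type*} [NormedAddCommGroup E] [NormedSpace ℝ E]
    {F f : ℝ → E} {p : ENNReal} {a : ℝ} (h : IsPrimitive F f) (hp : p ≠ 0) (hp' : p ≠ ⊤)
    (hF : MemLp F p (volume.restrict (Ioi a))) (hf : IntegrableOn f (Ioi a)) :
    F a = -∫ x in Ioi a, f x := by
  have hlim : Tendsto F atTop (𝓝 (F a + ∫ x in Ioi a, f x)) := by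
    rw [h.eq_add_integral a]
    simpa using tendsto_const_nhds.add (intervalIntegral_tendsto_integral_Ioi a hf tendsto_id)
  have hpow : ‖F a + ∫ x in Ioi a, f x‖ ^ p.toReal = 0 := by
    refine IntegrableAtFilter.eq_zero_of_tendsto (l := atTop) (μ := volume)
      ⟨Ioi a, Ioi_mem_atTop a, hF.integrable_norm_rpow hp hp'⟩ (fun s hs => ?_)
      (hlim.norm.rpow_const (Or.inr ENNReal.toReal_nonneg))
    obtain ⟨b, hb⟩ := mem_atTop_sets.mp hs
    rw [← top_le_iff, ← Real.volume_Ici (a := b)]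
    exact measure_mono hb
  rw [Real.rpow_eq_zero (norm_nonneg _) (ENNReal.toReal_ne_zero.mpr ⟨hp, hp'⟩), norm_eq_zero]
    at hpow
  exact eq_neg_of_add_eq_zero_left hpow

theorem norm_cexp_mul_ofReal_le_one {c : ℂ} {x : ℝ} (h : c.re * x ≤ 0) : ‖exp (c * x)‖ ≤ 1 := by
  rwa [norm_exp, re_mul_ofReal, Real.exp_le_one_iff]

theorem IsPrimitive.cexp_mul {F f : ℝ → ℂ} (h : IsPrimitive F f) (c : ℂ) (a : ℝ) :
    IsPrimitive (fun x => exp (c * ((x - a : ℝ) : ℂ)) * F x)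
      (fun x => exp (c * ((x - a : ℝ) : ℂ)) * (f x + c * F x)) := by
  have hexp : IsPrimitive (fun x : ℝ => exp (c * ((x - a : ℝ) : ℂ)))
      (fun x => exp (c * ((x - a : ℝ) : ℂ)) * c) :=
    .of_hasDerivAt (fun x => by
      simpa using (((hasDerivAt_id x).sub_const a).ofReal_comp.const_mul c).cexp) (by fun_prop)
  refine (hexp.smul h).congr_ae (.of_forall fun x => ?_)
  simp only [smul_eq_mul]
  ring

-- The factor `exp (-c (x - a))` turns `f - c F` into a derivative; square integrability kills the
-- boundary term at infinity.
theorem IsPrimitive.norm_le_integral_Ioi_norm_sub_mul {F f : ℝ → ℂ} {c : ℂ} {a : ℝ}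
    (h : IsPrimitive F f) (hc : 0 ≤ c.re) (hF : MemLp F 2 (volume.restrict (Ioi a)))
    (hf : IntegrableOn (fun x => f x - c * F x) (Ioi a)) :
    ‖F a‖ ≤ ∫ x in Ioi a, ‖f x - c * F x‖ := by
  have hexp : ∀ᵐ x ∂volume.restrict (Ioi a), ‖exp (-c * ((x - a : ℝ) : ℂ))‖ ≤ 1 :=
    ae_restrict_of_forall_mem measurableSet_Ioi fun x hx => norm_cexp_mul_ofReal_le_one (by
      rw [neg_re, neg_mul, neg_nonpos]
      exact mul_nonneg hc (sub_nonneg.mpr hx.le))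
  have hcont : Continuous fun x : ℝ => exp (-c * ((x - a : ℝ) : ℂ)) := by fun_prop
  have hmem : MemLp (fun x => exp (-c * ((x - a : ℝ) : ℂ)) * F x) 2 (volume.restrict (Ioi a)) :=
    hF.of_le (hcont.aestronglyMeasurable.mul hF.aestronglyMeasurable) <| hexp.mono fun x hx => by
      rw [norm_mul]
      exact mul_le_of_le_one_left (norm_nonneg _) hx
  have hprim := h.cexp_mul (-c) a
  simp only [neg_mul c (F _), ← sub_eq_add_neg] at hprim
  have key := hprim.eq_neg_integral_Ioi two_ne_zero ENNReal.ofNat_ne_top hmem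
    (hf.integrable.bdd_mul hcont.aestronglyMeasurable hexp)
  rw [sub_self, ofReal_zero, mul_zero, exp_zero, one_mul] at key
  rw [key, norm_neg]
  refine norm_integral_le_of_norm_le hf.norm <| hexp.mono fun x hx => ?_
  rw [norm_mul]
  exact mul_le_of_le_one_left (norm_nonneg _) hx

theorem IsPrimitive.norm_le_add_integral_norm_add_mul {F f : ℝ → ℂ} {c : ℂ} {a b : ℝ}
    (h : IsPrimitive F f) (hc : 0 ≤ c.re) (hab : a ≤ b) :
    ‖F b‖ ≤ ‖F a‖ + ∫ x in a..b, ‖f x + c * F x‖ := by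
  have hexp {x : ℝ} (hx : x ≤ b) : ‖exp (c * ((x - b : ℝ) : ℂ))‖ ≤ 1 :=
    norm_cexp_mul_ofReal_le_one (mul_nonpos_of_nonneg_of_nonpos hc (sub_nonpos.mpr hx))
  have key := (h.cexp_mul c b).integral_eq_sub a b
  rw [sub_self, ofReal_zero, mul_zero, exp_zero, one_mul, eq_sub_iff_add_eq] at key
  rw [← key, add_comm]
  refine (norm_add_le _ _).trans (add_le_add ?_ ?_)
  · rw [norm_mul]
    exact mul_le_of_le_one_left (norm_nonneg _) (hexp hab)
  · refine intervalIntegral.norm_integral_le_of_norm_le hab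
      (Eventually.of_forall fun x hx => ?_) ((h.intervalIntegrable a b).add
        ((h.continuous.const_mul c).intervalIntegrable a b)).norm
    rw [norm_mul]
    exact mul_le_of_le_one_left (norm_nonneg _) (hexp hx.2)

theorem isPrimitive_integral_Ioi {E : Type*} [NormedAddCommGroup E] [NormedSpace ℝ E]
    {f : ℝ → E} (hf : Integrable f) :
    IsPrimitive (fun x => ∫ y in Ioi x, f y) (fun x => -f x) where
  locallyIntegrable := hf.neg.locallyIntegrable
  integral_eq_sub a b := by
    rw [intervalIntegral.integral_neg, neg_eq_iff_eq_neg, neg_sub,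
      intervalIntegral.integral_Ioi_sub_Ioi' hf.integrableOn hf.integrableOn]

theorem intervalIntegral_integral_Ioi_le {g : ℝ → ℝ} (hg0 : ∀ y, 0 ≤ g y) (hg : Integrable g)
    (hyg : Integrable fun y => |y| * g y) {x : ℝ} (hx : 0 ≤ x) :
    ∫ s in (0 : ℝ)..x, ∫ y in Ioi s, g y ≤ ∫ y in Ioi 0, |y| * g y := by
  have hyg' : IntervalIntegrable (fun s => |s| * g s) volume 0 x := hyg.intervalIntegrable
  have hG := isPrimitive_integral_Ioi hg
  have hGi : IntervalIntegrable (fun s => ∫ y in Ioi s, g y) volume 0 x :=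
    hG.continuous.intervalIntegrable 0 x
  have hparts : ∫ s in (0 : ℝ)..x, ∫ y in Ioi s, g y =
      x * (∫ y in Ioi x, g y) + ∫ s in (0 : ℝ)..x, |s| * g s := by
    have h := ((IsPrimitive.of_hasDerivAt hasDerivAt_id continuous_const).smul
      hG).integral_eq_sub 0 x
    simp only [id, smul_eq_mul, one_mul, zero_mul, sub_zero] at h
    rw [← h, ← intervalIntegral.integral_add _ hyg']
    · refine intervalIntegral.integral_congr fun s hs => ?_
      rw [uIcc_of_le hx] at hs
      simp only [abs_of_nonneg hs.1]
      ring
    · simp only [mul_neg]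
      exact ((hg.intervalIntegrable.continuousOn_mul continuousOn_id).neg).add hGi
  have htail : x * ∫ y in Ioi x, g y ≤ ∫ y in Ioi x, |y| * g y := by
    rw [← integral_const_mul]
    refine setIntegral_mono_on (hg.const_mul x).integrableOn hyg.integrableOn measurableSet_Ioi
      fun y hy => ?_
    exact mul_le_mul_of_nonneg_right ((mem_Ioi.mp hy).le.trans (le_abs_self y)) (hg0 y)
  rw [hparts, ← intervalIntegral.integral_interval_add_Ioi hyg.integrableOn hyg.integrableOn,
    add_comm]
  gcongr

end HalfLine

section Solution

theorem integral_mul_norm_mul_le {α R : Type*} [MeasurableSpace α] {μ : Measure α}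
    [SeminormedRing R] {w : α → ℝ} {f g : α → R} {M : ℝ} (hw : ∀ x, 0 ≤ w x)
    (hM : ∀ x, ‖g x‖ ≤ M) (hwf : Integrable (fun x => w x * ‖f x‖) μ) :
    ∫ x, w x * ‖f x * g x‖ ∂μ ≤ (∫ x, w x * ‖f x‖ ∂μ) * M := by
  rw [← integral_mul_const]
  refine integral_mono_of_nonneg (.of_forall fun x => mul_nonneg (hw x) (norm_nonneg _))
    (hwf.mul_const M) (.of_forall fun x => ?_)
  calc w x * ‖f x * g x‖ ≤ w x * (‖f x‖ * M) :=
        mul_le_mul_of_nonneg_left (norm_mul_le_of_le le_rfl (hM x)) (hw x)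
    _ = w x * ‖f x‖ * M := (mul_assoc _ _ _).symm

/-- `u` is an `L²` solution of the Schrödinger equation `u'' = q u` with `u' = v` also in `L²`. -/
structure IsL2Solution (q u v : ℝ → ℂ) : Prop where
  isPrimitive : IsPrimitive u v
  isPrimitive_deriv : IsPrimitive v (fun x => q x * u x)
  memLp : MemLp u 2
  memLp_deriv : MemLp v 2

namespace IsL2Solution

variable {q u v W : ℝ → ℂ} {k m : ℂ}

theorem comp_neg (h : IsL2Solution q u v) :
    IsL2Solution (fun x => q (-x)) (fun x => u (-x)) (fun x => -v (-x)) where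
  isPrimitive := h.isPrimitive.comp_neg
  isPrimitive_deriv := by simpa using h.isPrimitive_deriv.comp_neg.const_smul (-1 : ℝ)
  memLp := h.memLp.comp_measurePreserving (Measure.measurePreserving_neg volume)
  memLp_deriv := (h.memLp_deriv.comp_measurePreserving (Measure.measurePreserving_neg volume)).neg

theorem exists_norm_le (h : IsL2Solution q u v) : ∃ M, ∀ x, ‖u x‖ ≤ M := by
  -- `(u²)' = 2 u u'` is integrable, although `u'` itself need not be.
  have hsq := h.isPrimitive.smul h.isPrimitive
  have hint : Integrable fun x => u x • v x + v x • u x :=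
    (h.memLp.integrable_mul h.memLp_deriv).add (h.memLp_deriv.integrable_mul h.memLp)
  refine ⟨√(‖u 0 • u 0‖ + ∫ x, ‖u x • v x + v x • u x‖), fun x => Real.le_sqrt_of_sq_le ?_⟩
  rw [sq, ← norm_smul]
  exact hsq.norm_le_add_integral_norm hint x

theorem norm_deriv_add_mul_le (h : IsL2Solution q u v) (hk : 0 ≤ k.re)
    (hq : ∀ x, 0 < x → q x = k ^ 2 + W x) (hW : Integrable fun x => W x * u x) {x : ℝ}
    (hx : 0 ≤ x) : ‖v x + k * u x‖ ≤ ∫ y in Ioi x, ‖W y * u y‖ := by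
  have hA : IsPrimitive (fun y => v y + k * u y) (fun y => q y * u y + k * v y) :=
    h.isPrimitive_deriv.add (h.isPrimitive.const_smul k)
  have hAW : EqOn (fun y => q y * u y + k * v y - k * (v y + k * u y)) (fun y => W y * u y)
      (Ioi x) := fun y hy => by
    simp only [hq y (hx.trans_lt hy)]
    ring
  refine (hA.norm_le_integral_Ioi_norm_sub_mul hk
    ((h.memLp_deriv.add (h.memLp.const_mul k)).restrict _)
    (hW.integrableOn.congr_fun hAW.symm measurableSet_Ioi)).trans_eq ?_
  exact setIntegral_congr_fun measurableSet_Ioi fun y hy => congrArg norm (hAW hy)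

theorem norm_le_add_integral_Ioi (h : IsL2Solution q u v) (hk : 0 ≤ k.re)
    (hq : ∀ x, 0 < x → q x = k ^ 2 + W x) (hW : Integrable fun x => W x * u x)
    (hyW : Integrable fun x => |x| * ‖W x * u x‖) {x : ℝ} (hx : 0 ≤ x) :
    ‖u x‖ ≤ ‖u 0‖ + ∫ y in Ioi 0, |y| * ‖W y * u y‖ := by
  have hcont : Continuous fun s => ‖v s + k * u s‖ :=
    (h.isPrimitive_deriv.continuous.add (h.isPrimitive.continuous.const_mul k)).norm
  calc ‖u x‖ ≤ ‖u 0‖ + ∫ s in 0..x, ‖v s + k * u s‖ :=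
        h.isPrimitive.norm_le_add_integral_norm_add_mul hk hx
    _ ≤ ‖u 0‖ + ∫ s in 0..x, ∫ y in Ioi s, ‖W y * u y‖ := by
        gcongr
        exact intervalIntegral.integral_mono_on hx (hcont.intervalIntegrable 0 x)
          ((isPrimitive_integral_Ioi hW.norm).continuous.intervalIntegrable 0 x)
          fun s hs => h.norm_deriv_add_mul_le hk hq hW hs.1
    _ ≤ ‖u 0‖ + ∫ y in Ioi 0, |y| * ‖W y * u y‖ := by
        gcongr
        exact intervalIntegral_integral_Ioi_le (fun _ => norm_nonneg _) hW.norm hyW hx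

theorem norm_le_add_integral (h : IsL2Solution q u v) (hk : 0 ≤ k.re) (hm : 0 ≤ m.re)
    (hqk : ∀ x, 0 < x → q x = k ^ 2 + W x) (hqm : ∀ x, x < 0 → q x = m ^ 2 + W x)
    (hW : Integrable fun x => W x * u x) (hxW : Integrable fun x => |x| * ‖W x * u x‖) (x : ℝ) :
    ‖u x‖ ≤ ‖u 0‖ + ∫ y, |y| * ‖W y * u y‖ := by
  have hnonneg (y : ℝ) : 0 ≤ |y| * ‖W y * u y‖ := by positivity
  rcases le_total 0 x with hx | hx
  · refine (h.norm_le_add_integral_Ioi hk hqk hW hxW hx).trans ?_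
    gcongr ‖u 0‖ + ?_
    exact setIntegral_le_integral hxW (.of_forall hnonneg)
  · have hneg := h.comp_neg.norm_le_add_integral_Ioi (W := fun y => W (-y)) hm
      (fun y hy => hqm (-y) (neg_lt_zero.mpr hy)) hW.comp_neg
      (by simpa only [abs_neg] using hxW.comp_neg) (neg_nonneg.mpr hx)
    simp only [neg_neg, neg_zero] at hneg
    refine hneg.trans ?_
    gcongr ‖u 0‖ + ?_
    rw [← integral_neg_eq_self fun y => |y| * ‖W y * u y‖]
    simp only [abs_neg]
    exact setIntegral_le_integral (by simpa only [abs_neg] using hxW.comp_neg)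
      (.of_forall fun y => by positivity)

theorem norm_add_mul_norm_zero_le (h : IsL2Solution q u v) (hk : 0 ≤ k.re) (hm : 0 ≤ m.re)
    (hqk : ∀ x, 0 < x → q x = k ^ 2 + W x) (hqm : ∀ x, x < 0 → q x = m ^ 2 + W x)
    (hW : Integrable fun x => W x * u x) : ‖k + m‖ * ‖u 0‖ ≤ ∫ x, ‖W x * u x‖ := by
  have hright := h.norm_deriv_add_mul_le hk hqk hW le_rfl
  have hleft := h.comp_neg.norm_deriv_add_mul_le (W := fun y => W (-y)) hm
    (fun y hy => hqm (-y) (neg_lt_zero.mpr hy)) hW.comp_neg le_rfl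
  rw [integral_comp_neg_Ioi 0 fun y => ‖W y * u y‖, neg_zero] at hleft
  calc ‖k + m‖ * ‖u 0‖ = ‖-v 0 + m * u 0 + (v 0 + k * u 0)‖ := by
        rw [← norm_mul]
        congr 1
        ring
    _ ≤ (∫ y in Iic 0, ‖W y * u y‖) + ∫ y in Ioi 0, ‖W y * u y‖ :=
        norm_add_le_of_le hleft hright
    _ = ∫ x, ‖W x * u x‖ :=
        intervalIntegral.integral_Iic_add_Ioi hW.norm.integrableOn hW.norm.integrableOn

theorem norm_add_le_two_mul_integral (h : IsL2Solution q u v) (hu : u ≠ 0) (hk : 0 ≤ k.re)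
    (hm : 0 ≤ m.re) (hqk : ∀ x, 0 < x → q x = k ^ 2 + W x)
    (hqm : ∀ x, x < 0 → q x = m ^ 2 + W x) (hW : Integrable W)
    (hxW : Integrable fun x => |x| * ‖W x‖) (hsmall : ∫ x, |x| * ‖W x‖ ≤ 1 / 2) :
    ‖k + m‖ ≤ 2 * ∫ x, ‖W x‖ := by
  obtain ⟨B, hB⟩ := h.exists_norm_le
  have hucont := h.isPrimitive.continuous
  set M := ⨆ x, ‖u x‖
  have hM (x : ℝ) : ‖u x‖ ≤ M := le_ciSup ⟨B, forall_mem_range.mpr hB⟩ x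
  have hMpos : 0 < M := by
    obtain ⟨x, hx⟩ := Function.ne_iff.mp hu
    exact (norm_pos_iff.mpr hx).trans_le (hM x)
  have hWu : Integrable fun x => W x * u x :=
    hW.mul_bdd hucont.aestronglyMeasurable (.of_forall hM)
  have hxWu : Integrable fun x => |x| * ‖W x * u x‖ := by
    simpa only [norm_mul, mul_assoc] using
      hxW.mul_bdd hucont.norm.aestronglyMeasurable
        (.of_forall fun x => (norm_norm _).trans_le (hM x))
  have hxle : ∫ x, |x| * ‖W x * u x‖ ≤ M / 2 := by
    refine (integral_mul_norm_mul_le (fun x => abs_nonneg x) hM hxW).trans ?_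
    nlinarith
  have hM0 : M / 2 ≤ ‖u 0‖ := by
    have hsup : M ≤ ‖u 0‖ + M / 2 := ciSup_le fun x =>
      (h.norm_le_add_integral hk hm hqk hqm hWu hxWu x).trans (by gcongr)
    linarith
  refine le_of_mul_le_mul_right ?_ (half_pos hMpos)
  calc ‖k + m‖ * (M / 2) ≤ ‖k + m‖ * ‖u 0‖ := by gcongr
    _ ≤ ∫ x, ‖W x * u x‖ := h.norm_add_mul_norm_zero_le hk hm hqk hqm hWu
    _ ≤ (∫ x, ‖W x‖) * M := by
        simpa only [one_mul] using
          integral_mul_norm_mul_le (fun _ => zero_le_one) hM (hW.norm.const_mul 1)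
    _ = 2 * (∫ x, ‖W x‖) * (M / 2) := by ring

end IsL2Solution

end Solution

section Exponent

variable {k m z : ℂ}

theorem exists_sq_eq_and_re_nonneg (w : ℂ) : ∃ k : ℂ, k ^ 2 = w ∧ 0 ≤ k.re := by
  obtain ⟨k, hk⟩ := IsAlgClosed.exists_pow_nat_eq w two_pos
  rcases le_total 0 k.re with h | h
  · exact ⟨k, hk, h⟩
  · exact ⟨-k, by rw [neg_sq, hk], by simpa using h⟩

theorem closure_halfStrip : closure halfStrip = Ici 0 ×ℂ Icc (-1) 1 := by
  have : halfStrip = Ici 0 ×ℂ Ioo (-1) 1 := by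
    ext z
    simp [halfStrip, mem_reProdIm]
  rw [this, closure_reProdIm, closure_Ioo (by norm_num), closure_Ici]

theorem normSq_add_pos (h : (k + m) * (k - m) = 2 * I) : 0 < normSq (k + m) :=
  normSq_pos.mpr (left_ne_zero_of_mul (h.trans_ne (mul_ne_zero two_ne_zero I_ne_zero)))

-- These express `k - m = 2i / (k + m)` through `k + m` without a division.
theorem normSq_add_mul_sub (h : (k + m) * (k - m) = 2 * I) :
    normSq (k + m) * (k - m) = 2 * I * conj (k + m) := by
  rw [normSq_eq_conj_mul_self, mul_assoc, h, mul_comm]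

theorem normSq_add_mul_sub_re (h : (k + m) * (k - m) = 2 * I) :
    normSq (k + m) * (k - m).re = 2 * (k + m).im := by
  rw [← re_ofReal_mul, normSq_add_mul_sub h]
  generalize k + m = s
  simp

theorem normSq_add_mul_sub_im (h : (k + m) * (k - m) = 2 * I) :
    normSq (k + m) * (k - m).im = 2 * (k + m).re := by
  rw [← im_ofReal_mul, normSq_add_mul_sub h]
  generalize k + m = s
  simp

theorem two_mul_abs_add_im_le (h : (k + m) * (k - m) = 2 * I) (hk : 0 ≤ k.re) (hm : 0 ≤ m.re) :
    2 * |(k + m).im| ≤ normSq (k + m) * (k + m).re := by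
  have hsub : |(k - m).re| ≤ (k + m).re := by
    rw [sub_re, add_re, abs_le]
    constructor <;> linarith
  calc 2 * |(k + m).im| = normSq (k + m) * |(k - m).re| := by
        rw [← abs_two, ← abs_mul, ← normSq_add_mul_sub_re h, abs_mul,
          abs_of_nonneg (normSq_nonneg _)]
    _ ≤ normSq (k + m) * (k + m).re := mul_le_mul_of_nonneg_left hsub (normSq_nonneg _)

theorem abs_add_im_le_sub_im (h : (k + m) * (k - m) = 2 * I) (hk : 0 ≤ k.re) (hm : 0 ≤ m.re)
    (hs : normSq (k + m) ≤ 1) : |(k + m).im| ≤ (k - m).im := by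
  refine le_of_mul_le_mul_left ?_ (normSq_add_pos h)
  have hre : 0 ≤ (k + m).re := add_nonneg hk hm
  calc normSq (k + m) * |(k + m).im| ≤ 2 * |(k + m).im| := by
        gcongr
        linarith
    _ ≤ normSq (k + m) * (k + m).re := two_mul_abs_add_im_le h hk hm
    _ ≤ 2 * (k + m).re := by
        gcongr
        linarith
    _ = normSq (k + m) * (k - m).im := (normSq_add_mul_sub_im h).symm

theorem add_mul_sub_eq_two_mul_I (hk : k ^ 2 = I - z) (hm : m ^ 2 = -I - z) :
    (k + m) * (k - m) = 2 * I := by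
  linear_combination hk - hm

theorem abs_im_le_one_of_normSq_add_le_one (hk : k ^ 2 = I - z) (hm : m ^ 2 = -I - z)
    (hk0 : 0 ≤ k.re) (hm0 : 0 ≤ m.re) (hs : normSq (k + m) ≤ 1) : |z.im| ≤ 1 := by
  obtain ⟨hlower, hupper⟩ := abs_le.mp
    (abs_add_im_le_sub_im (add_mul_sub_eq_two_mul_I hk hm) hk0 hm0 hs)
  rw [add_im, sub_im] at hlower hupper
  have hkim : 2 * k.re * k.im = 1 - z.im := by
    have := congrArg im hk
    simp only [sq, mul_im, sub_im, I_im] at this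
    linarith
  have hmim : 2 * m.re * m.im = -1 - z.im := by
    have := congrArg im hm
    simp only [sq, mul_im, sub_im, neg_im, I_im] at this
    linarith
  rw [abs_le]
  constructor <;> nlinarith

theorem four_mul_sq_normSq_add_mul_re (hk : k ^ 2 = I - z) (hm : m ^ 2 = -I - z) :
    4 * normSq (k + m) ^ 2 * z.re =
      (4 - normSq (k + m) ^ 2) * ((k + m).re ^ 2 - (k + m).im ^ 2) := by
  have h := add_mul_sub_eq_two_mul_I hk hm
  have hz : 4 * z.re =
      (k + m).im ^ 2 + (k - m).im ^ 2 - (k + m).re ^ 2 - (k - m).re ^ 2 := by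
    have : 4 * z = -((k + m) ^ 2 + (k - m) ^ 2) := by linear_combination 2 * hk + 2 * hm
    have := congrArg re this
    simp only [sq, mul_re, neg_re, add_re, add_im, sub_re, sub_im, re_ofNat, im_ofNat] at this ⊢
    linarith
  linear_combination normSq (k + m) ^ 2 * hz +
    (normSq (k + m) * (k - m).im + 2 * (k + m).re) * normSq_add_mul_sub_im h -
    (normSq (k + m) * (k - m).re + 2 * (k + m).im) * normSq_add_mul_sub_re h

theorem one_le_four_mul_normSq_add_mul_re (hk : k ^ 2 = I - z) (hm : m ^ 2 = -I - z)
    (hk0 : 0 ≤ k.re) (hm0 : 0 ≤ m.re) (hs : normSq (k + m) ≤ 1) :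
    1 ≤ 4 * normSq (k + m) * z.re := by
  have h := add_mul_sub_eq_two_mul_I hk hm
  have hpos := normSq_add_pos h
  have hre : 0 ≤ (k + m).re := add_nonneg hk0 hm0
  have him : 4 * (k + m).im ^ 2 ≤ (k + m).re ^ 2 := by
    have := (two_mul_abs_add_im_le h hk0 hm0).trans (mul_le_of_le_one_left hre hs)
    calc 4 * (k + m).im ^ 2 = (2 * |(k + m).im|) ^ 2 := by rw [mul_pow, sq_abs]; norm_num
      _ ≤ (k + m).re ^ 2 := by gcongr
  have hdiff : normSq (k + m) ≤ 3 * ((k + m).re ^ 2 - (k + m).im ^ 2) := by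
    rw [normSq_apply]
    nlinarith
  refine le_of_mul_le_mul_left ?_ hpos
  calc normSq (k + m) * 1 ≤ 3 * ((k + m).re ^ 2 - (k + m).im ^ 2) := by rwa [mul_one]
    _ ≤ (4 - normSq (k + m) ^ 2) * ((k + m).re ^ 2 - (k + m).im ^ 2) := by
        gcongr
        · linarith
        · nlinarith
    _ = normSq (k + m) * (4 * normSq (k + m) * z.re) := by
        rw [← four_mul_sq_normSq_add_mul_re hk hm]
        ring

theorem mem_closure_halfStrip_and_one_le (hk : k ^ 2 = I - z) (hm : m ^ 2 = -I - z)
    (hk0 : 0 ≤ k.re) (hm0 : 0 ≤ m.re) (hs : ‖k + m‖ ≤ 1) :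
    z ∈ closure halfStrip ∧ 1 ≤ 4 * ‖k + m‖ ^ 2 * z.re := by
  have hs' : normSq (k + m) ≤ 1 := by
    rw [normSq_eq_norm_sq]
    exact pow_le_one₀ (norm_nonneg _) hs
  have hre := one_le_four_mul_normSq_add_mul_re hk hm hk0 hm0 hs'
  rw [closure_halfStrip, ← normSq_eq_norm_sq]
  refine ⟨⟨?_, abs_le.mp (abs_im_le_one_of_normSq_add_le_one hk hm hk0 hm0 hs')⟩, hre⟩
  exact (pos_of_mul_pos_right (one_pos.trans_le hre)
    (mul_nonneg zero_le_four (normSq_nonneg _))).le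

end Exponent

section Eigenfunction

theorem isWeakDeriv_toLp {u v : ℝ → ℂ} (h : IsPrimitive u v) (hu : MemLp u 2) (hv : MemLp v 2) :
    IsWeakDeriv hu.toLp hv.toLp := by
  intro χ hχ hc
  have hsmul (w : ℝ → ℝ) {f : ℝ → ℂ} (hf : MemLp f 2 volume) :
      ∫ x, w x • (hf.toLp : L2) x = ∫ x, w x • f x :=
    integral_congr_ae (hf.coeFn_toLp.mono fun _ hx => by simp only [hx])
  rw [hsmul, hsmul, h.integral_deriv_smul (hχ.of_le (by simp)) hc]

theorem isWeakDeriv_weakDeriv (f : W12) : IsWeakDeriv f (weakDeriv f) :=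
  f.2.choose_spec

theorem weakDeriv_eq {f g : L2} (h : IsWeakDeriv f g) : weakDeriv ⟨f, g, h⟩ = g :=
  (isWeakDeriv_weakDeriv ⟨f, g, h⟩).unique h

theorem toLp_mem_potentialDom {V : ℝ → ℂ} (hV : Integrable V) {g : ℝ → ℂ}
    (hg : MemLp g 2 volume) {M : ℝ} (hM : ∀ x, ‖g x‖ ≤ M) : hg.toLp ∈ potentialDom V := by
  have hm : AEStronglyMeasurable (fun x => (√‖V x‖ : ℂ)) volume :=
    (by fun_prop : Continuous fun c : ℂ => (√‖c‖ : ℂ)).comp_aestronglyMeasurable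
      hV.aestronglyMeasurable
  have hs : MemLp (fun x => (√‖V x‖ : ℂ)) 2 volume := by
    rw [memLp_two_iff_integrable_sq_norm hm]
    simpa [Real.sq_sqrt] using hV.norm
  refine MemLp.ae_eq (hg.coeFn_toLp.mono fun x hx => congrArg ((√‖V x‖ : ℂ) * ·) hx.symm)
    (hs.of_le_mul (c := M) (hm.mul hg.aestronglyMeasurable) (.of_forall fun x => ?_))
  rw [norm_mul, mul_comm]
  gcongr
  exact hM x

/-- The unperturbed potential `i sgn x`. -/
noncomputable def stepPotential (x : ℝ) : ℂ :=
  I * Real.sign x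

theorem stepPotential_of_pos {x : ℝ} (hx : 0 < x) : stepPotential x = I := by
  simp [stepPotential, Real.sign_of_pos hx]

theorem stepPotential_of_neg {x : ℝ} (hx : x < 0) : stepPotential x = -I := by
  simp [stepPotential, Real.sign_of_neg hx]

theorem norm_stepPotential_le_one (x : ℝ) : ‖stepPotential x‖ ≤ 1 := by
  rcases Real.sign_apply_eq x with h | h | h <;> simp [stepPotential, h]

theorem aestronglyMeasurable_stepPotential : AEStronglyMeasurable stepPotential := by
  have hsign : Measurable Real.sign :=
    .ite measurableSet_Iio measurable_const (.ite measurableSet_Ioi measurable_const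
      measurable_const)
  exact (measurable_const.mul (measurable_ofReal.comp hsign)).aestronglyMeasurable

theorem integrable_stepPotential_mul {f : ℝ → ℂ} (hf : Integrable f) :
    Integrable fun x => stepPotential x * f x :=
  hf.bdd_mul aestronglyMeasurable_stepPotential (.of_forall norm_stepPotential_le_one)

theorem locallyIntegrable_stepPotential : LocallyIntegrable stepPotential :=
  (locallyIntegrable_const (1 : ℝ)).mono aestronglyMeasurable_stepPotential
    (.of_forall fun x => by simpa using norm_stepPotential_le_one x)

theorem integral_stepPotential_mul {f : ℝ → ℂ} (hf : Integrable f) :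
    ∫ x, stepPotential x * f x = I * (∫ x in Ioi 0, f x) - I * ∫ x in Iio 0, f x := by
  have hi := integrable_stepPotential_mul hf
  rw [← intervalIntegral.integral_Iic_add_Ioi (b := 0) hi.integrableOn hi.integrableOn,
    integral_Iic_eq_integral_Iio, add_comm, sub_eq_add_neg, ← neg_mul, ← integral_const_mul,
    ← integral_const_mul]
  congr 1
  · exact setIntegral_congr_fun measurableSet_Ioi fun x hx => by
      simp only [stepPotential_of_pos hx]
  · exact setIntegral_congr_fun measurableSet_Iio fun x hx => by
      simp only [stepPotential_of_neg hx]

variable {V : ℝ → ℂ} {hV : Integrable V} {ε : ℝ}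

theorem integrable_potential_mul_conj (ψ φ : (perturbedForm V hV ε).dom) :
    Integrable fun x => (stepPotential x + ε * V x) * ((ψ : L2) x * conj ((φ : L2) x)) := by
  simp only [add_mul, mul_assoc]
  exact (integrable_stepPotential_mul (integrable_mul_conj ψ φ)).add
    (by simpa only [mul_assoc] using
      (integrable_potential hV ψ.2.2 φ.2.2).const_mul (ε : ℂ))

theorem perturbedForm_apply (ψ φ : (perturbedForm V hV ε).dom) :
    (perturbedForm V hV ε).form ψ φ =
      inner ℂ (weakDeriv ⟨φ, φ.2.1⟩) (weakDeriv ⟨ψ, ψ.2.1⟩) +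
        ∫ x, (stepPotential x + ε * V x) * ((ψ : L2) x * conj ((φ : L2) x)) := by
  have hexpand : (perturbedForm V hV ε).form ψ φ =
      inner ℂ (weakDeriv ⟨φ, φ.2.1⟩) (weakDeriv ⟨ψ, ψ.2.1⟩) +
        (I * (∫ x in Ioi 0, (ψ : L2) x * conj ((φ : L2) x)) -
          I * ∫ x in Iio 0, (ψ : L2) x * conj ((φ : L2) x)) +
        ε * ∫ x, V x * (ψ : L2) x * conj ((φ : L2) x) := rfl
  rw [hexpand, ← integral_stepPotential_mul (integrable_mul_conj ψ φ), ← integral_const_mul,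
    add_assoc, ← integral_add (integrable_stepPotential_mul (integrable_mul_conj ψ φ))
      ((integrable_potential hV ψ.2.2 φ.2.2).const_mul (ε : ℂ))]
  simp only [add_mul, mul_assoc]

theorem inner_toLp_ofReal {χ : ℝ → ℝ} (hχ : MemLp (fun x => (χ x : ℂ)) 2) (g : L2) :
    inner ℂ (hχ.toLp : L2) g = ∫ x, χ x • g x := by
  rw [L2.inner_def]
  refine integral_congr_ae (hχ.coeFn_toLp.mono fun x hx => ?_)
  simp [hx, mul_comm]

theorem integral_deriv_smul_weakDeriv {z : ℂ} {ψ : (perturbedOperator V hV ε).domain}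
    (h : perturbedOperator V hV ε ψ = z • (ψ : L2)) (hψ : (ψ : L2) ∈ W12) {χ : ℝ → ℝ}
    (hχ : ContDiff ℝ ∞ χ) (hc : HasCompactSupport χ) :
    ∫ x, deriv χ x • weakDeriv ⟨ψ, hψ⟩ x =
      -∫ x, χ x • ((stepPotential x + ε * V x - z) * (ψ : L2) x) := by
  have hdχ : Continuous (deriv χ) := hχ.continuous_deriv (by simp)
  have hmem : MemLp (fun x => (χ x : ℂ)) 2 volume :=
    (hχ.continuous.memLp_of_hasCompactSupport hc).ofReal
  have hmem' : MemLp (fun x => ((deriv χ x : ℝ) : ℂ)) 2 volume :=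
    (hdχ.memLp_of_hasCompactSupport hc.deriv).ofReal
  have hweak : IsWeakDeriv hmem.toLp hmem'.toLp :=
    isWeakDeriv_toLp (.of_hasDerivAt
      (fun x => (hχ.differentiable (by simp) x).hasDerivAt.ofReal_comp) (by fun_prop)) _ _
  obtain ⟨M, hM⟩ := hc.exists_bound_of_continuous hχ.continuous
  have hdom : hmem.toLp ∈ (perturbedForm V hV ε).dom :=
    ⟨⟨_, hweak⟩, toLp_mem_potentialDom hV hmem fun x => (norm_real _).trans_le (hM x)⟩
  have key := (perturbedForm V hV ε).inner_operatorVal ψ ⟨_, hdom⟩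
  rw [show (perturbedForm V hV ε).operatorVal ψ = z • (ψ : L2) from h, inner_smul_right,
    perturbedForm_apply, weakDeriv_eq hweak, inner_toLp_ofReal, inner_toLp_ofReal,
    ← sub_eq_iff_eq_add] at key
  rw [← key, ← integral_const_mul, ← integral_sub
    ((integrable_test_smul _ hχ.continuous hc).const_mul z)
    (integrable_potential_mul_conj ⟨ψ, _⟩ ⟨_, hdom⟩), ← integral_neg]
  refine integral_congr_ae (hmem.coeFn_toLp.mono fun x hx => ?_)
  simp only [hx, conj_ofReal, real_smul]
  ring

theorem exists_isL2Solution_of_mem_pointSpectrum {z : ℂ}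
    (hz : z ∈ pointSpectrum (perturbedOperator V hV ε)) :
    ∃ u v : ℝ → ℂ, u ≠ 0 ∧ IsL2Solution (fun x => stepPotential x + ε * V x - z) u v := by
  obtain ⟨ψ, hψ0, hψ⟩ := hz
  have hW : (ψ : L2) ∈ W12 :=
    (SesqForm.mem_dom_of_mem_operatorDom (t := perturbedForm V hV ε) ψ).1
  have hloc (f : L2) : LocallyIntegrable f := (Lp.memLp f).locallyIntegrable (by norm_num)
  obtain ⟨u, hψu, hu⟩ :=
    exists_ae_eq_isPrimitive (hloc ψ) (hloc _) (isWeakDeriv_weakDeriv ⟨ψ, hW⟩)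
  have hq : LocallyIntegrable fun x => stepPotential x + ε * V x - z :=
    (locallyIntegrable_stepPotential.add (hV.const_mul (ε : ℂ)).locallyIntegrable).sub
      (locallyIntegrable_const z)
  obtain ⟨v, hv, hv'⟩ := exists_ae_eq_isPrimitive (hloc (weakDeriv ⟨ψ, hW⟩))
    (hq.smul_continuous hu.continuous) fun χ hχ hc => by
      rw [integral_deriv_smul_weakDeriv hψ hW hχ hc]
      exact congrArg Neg.neg
        (integral_congr_ae (hψu.mono fun x hx => by simp only [hx, smul_eq_mul]))
  refine ⟨u, v, ?_, hu.congr_ae hv, hv', (Lp.memLp (ψ : L2)).ae_eq hψu, (Lp.memLp _).ae_eq hv⟩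
  rintro rfl
  exact hψ0 ((Lp.eq_zero_iff_ae_eq_zero).mpr hψu)

end Eigenfunction

section WeightedL1

variable {V : ℝ → ℂ}

theorem WeightedL1.integrable_mul_norm (hV : WeightedL1 V) :
    Integrable fun x => (1 + x ^ 2) * ‖V x‖ := by
  refine hV.norm.congr (.of_forall fun x => ?_)
  simp only [norm_smul, Real.norm_of_nonneg (by positivity : 0 ≤ 1 + x ^ 2)]

theorem two_mul_abs_le_one_add_sq (x : ℝ) : 2 * |x| ≤ 1 + x ^ 2 := by
  simpa [add_comm] using two_mul_le_add_sq |x| 1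

theorem abs_mul_norm_le (x : ℝ) : |x| * ‖V x‖ ≤ (1 + x ^ 2) * ‖V x‖ := by
  gcongr
  linarith [two_mul_abs_le_one_add_sq x, abs_nonneg x]

theorem WeightedL1.integrable_abs_mul_norm (hV : WeightedL1 V) :
    Integrable fun x => |x| * ‖V x‖ :=
  hV.integrable_mul_norm.mono'
    (continuous_abs.aestronglyMeasurable.mul hV.integrable.aestronglyMeasurable.norm)
    (.of_forall fun x => by
      rw [Real.norm_of_nonneg (by positivity)]
      exact abs_mul_norm_le x)

theorem WeightedL1.integral_norm_le (hV : WeightedL1 V) :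
    ∫ x, ‖V x‖ ≤ ∫ x, (1 + x ^ 2) * ‖V x‖ :=
  integral_mono hV.integrable.norm hV.integrable_mul_norm fun x =>
    le_mul_of_one_le_left (norm_nonneg _) (le_add_of_nonneg_right (sq_nonneg x))

theorem WeightedL1.integral_abs_mul_norm_le (hV : WeightedL1 V) :
    ∫ x, |x| * ‖V x‖ ≤ ∫ x, (1 + x ^ 2) * ‖V x‖ :=
  integral_mono hV.integrable_abs_mul_norm hV.integrable_mul_norm abs_mul_norm_le

end WeightedL1

end HalfLineStep

theorem theorem3_general {V : ℝ → ℂ} (hV : Integrable V)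
    (hxV : Integrable fun x => |x| * ‖V x‖) {ε : ℝ} (hε : |ε| * ∫ x, ‖V x‖ ≤ 1 / 2)
    (hxε : |ε| * ∫ x, |x| * ‖V x‖ ≤ 1 / 2) {z : ℂ}
    (hz : z ∈ pointSpectrum (perturbedOperator V hV ε)) :
    z ∈ closure halfStrip ∧ 1 / 16 ≤ ε ^ 2 * (∫ x, ‖V x‖) ^ 2 * z.re := by
  obtain ⟨u, v, hu, huv⟩ := exists_isL2Solution_of_mem_pointSpectrum hz
  obtain ⟨k, hk, hk0⟩ := exists_sq_eq_and_re_nonneg (I - z)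
  obtain ⟨m, hm, hm0⟩ := exists_sq_eq_and_re_nonneg (-I - z)
  have hxW (x : ℝ) : |x| * ‖ε * V x‖ = |ε| * (|x| * ‖V x‖) := by
    rw [norm_mul, norm_real, Real.norm_eq_abs, mul_left_comm]
  have hsum : ‖k + m‖ ≤ 2 * ∫ x, ‖ε * V x‖ :=
    huv.norm_add_le_two_mul_integral hu hk0 hm0
      (fun x hx => by rw [stepPotential_of_pos hx, hk]; ring)
      (fun x hx => by rw [stepPotential_of_neg hx, hm]; ring) (hV.const_mul (ε : ℂ))
      (by simpa only [hxW] using hxV.const_mul |ε|)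
      (by simpa only [hxW, integral_const_mul] using hxε)
  simp only [norm_mul, norm_real, Real.norm_eq_abs, integral_const_mul] at hsum
  obtain ⟨hstrip, hre⟩ := mem_closure_halfStrip_and_one_le hk hm hk0 hm0 (by linarith)
  refine ⟨hstrip, ?_⟩
  have hz0 : 0 ≤ z.re := (closure_halfStrip ▸ hstrip).1
  calc 1 / 16 ≤ ‖k + m‖ ^ 2 * z.re / 4 := by linarith
    _ ≤ (2 * (|ε| * ∫ x, ‖V x‖)) ^ 2 * z.re / 4 := by gcongr
    _ = ε ^ 2 * (∫ x, ‖V x‖) ^ 2 * z.re := by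
        rw [mul_pow, mul_pow, sq_abs]
        ring

theorem theorem3 :
    ∃ C₁ C₂ : ℝ, 0 < C₁ ∧ 0 < C₂ ∧
      ∀ (V : ℝ → ℂ) (hV : WeightedL1 V) (ε : ℝ),
        |ε| * (∫ x, (1 + x ^ 2) * ‖V x‖) ≤ 1 / C₁ →
          ∀ z ∈ pointSpectrum (perturbedOperator V hV.integrable ε),
            z ∈ closure halfStrip ∧ C₂ ≤ ε ^ 2 * (∫ x, ‖V x‖) ^ 2 * z.re :=
  ⟨2, 1 / 16, two_pos, by norm_num, fun _ hV _ hε _ =>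
    theorem3_general hV.integrable hV.integrable_abs_mul_norm
      ((mul_le_mul_of_nonneg_left hV.integral_norm_le (abs_nonneg _)).trans hε)
      ((mul_le_mul_of_nonneg_left hV.integral_abs_mul_norm_le (abs_nonneg _)).trans hε)⟩
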